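/- Let $m,n\in\mathbb{N}_0$ and let $X(s)=(X_1(s),\dots,X_m(s))\in\mathbb{R}^m$, $s\in[0,1]$, be a zero-mean Gaussian process (all finite-dimensional distributions are jointly Gaussian) with $$\mathrm{Cov}(X_i(s),X_j(t))=f(s,t)\,\delta_{ij}\qquad (s,t\in[0,1],\ 1\le i,j\le m)$$ for some continuous function $f:[0,1]\times[0,1]\to\mathbb{R}$. Let $Q(x)=\sum_{\alpha\in\mathbb{N}_0^m}q_\alpha x^\alpha$ be a polynomial in $m$ variables with real coefficients, and fix a set $V=\{v_1,\dots,v_n\}$ of $n$ distinct vertices. A multigraph $\Gamma$ on a finite set $W$ is given by a multiplicity function $h$ that assigns to each set $\{v,w\}$ with $v,w\in W$ (where $v=w$ is allowed, $\{v\}$ being a loop) a number $h(\{v,w\})\in\mathbb{N}_0$. For such a $\Gamma$: * $\deg(v)=2h(\{v\})+\sum_{w\in W\setminus\{v\}}h(\{v,w\})$; * the sum of multigraphs on the same vertex set is obtained by adding the multiplicity functions; * a sub-multigraph is the restriction of $h$ to the pairs in a subset of $W$; $\Gamma$ is connected if any two distinct vertices are joined by a finite chain of vertices in which consecutive vertices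 have positive multiplicity; $\mathscr{C}(\Gamma)$ is the set of connected components of $\Gamma$, i.e. of its maximal connected sub-multigraphs; * for $\Gamma$ with vertices $w_1,\dots,w_l$, $$\int_\Gamma f:=\int_{[0,1]^l}\ \prod_{1\le a\le b\le l}f(s_a,s_b)^{h(\{w_a,w_b\})}\,\mathrm{d}s_1\cdots\mathrm{d}s_l ;$$ * for $\Gamma$ on $V$, $$C(\Gamma):=\frac{\prod_{j=1}^n \deg(v_j)!}{2^{\sum_{j=1}^n h(\{v_j\})}\ \prod_{1\le i\le j\le n}h(\{v_i,v_j\})!}.$$ Then $\prod_{k=1}^nQ(X(s_k))$ is integrable for all $s_1,\dots,s_n\in[0,1]$, its expectation is an integrable function of $(s_1,\dots,s_n)$ on $\{0\le s_1\le\dots\le s_n\le1\}$, and $$\int_{\{0\le s_1\le\dots\le s_n\le1\}}\mathbb{E}\Big[\prod_{k=1}^nQ(X(s_k))\Big]\,\mathrm{d}s_1\cdots\mathrm{d}s_n =\frac1{n!}\sum_{\substack{\alpha^{(1)},\dots,\alpha^{(n)}\in\mathbb{N}_0^m\\ \sum_{k=1}^n\sum_{i=1}^m\alpha^{(k)}_i\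 \text{even}}}\Big(\prod_{k=1}^nq_{\alpha^{(k)}}\Big)\sum_{\Gamma_1}\cdots\sum_{\Gamma_m}\Big(\prod_{q=1}^mC(\Gamma_q)\Big)\Big(\prod_{\Lambda\in\mathscr{C}(\Gamma_1+\cdots+\Gamma_m)}\int_\Lambda f\Big),$$ where, for each $q\in\{1,\dots,m\}$, the sum over $\Gamma_q$ runs over all multigraphs on $\{v_1,\dots,v_n\}$ with $\deg(v_j)=\alpha^{(j)}_q$ for all $j\in\{1,\dots,n\}$. -/

import Mathlib

open MeasureTheory ProbabilityTheory

/-- A finite undirected multigraph with loops on the vertex type `V`: the multiplicity of every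
unordered pair of vertices; the diagonal pair `s(v, v)` stands for the loop at `v`. -/
@[ext]
structure Multigraph (V : Type*) where
  mult : Sym2 V → ℕ

namespace Multigraph

variable {V : Type*}

/-- The degree of a vertex; every loop counts twice. -/
def degree [Fintype V] [DecidableEq V] (Γ : Multigraph V) (v : V) : ℕ :=
  2 * Γ.mult s(v, v) + ∑ w ∈ Finset.univ.erase v, Γ.mult s(v, w)

/-- Any two distinct vertices are joined by a finite chain of edges. -/
def Connected (Γ : Multigraph V) : Prop :=
  ∀ a b : V, a ≠ b → Relation.TransGen (fun x y => 1 ≤ Γ.mult s(x, y)) a b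

/-- The sub-multigraph with vertex set `S`: the multiplicities are restricted to pairs in `S`. -/
def induce (Γ : Multigraph V) (S : Finset V) : Multigraph S where
  mult e := Γ.mult (e.map Subtype.val)

open Classical in
/-- The vertex sets of the connected components, that is, of the connected sub-multigraphs that
are maximal under inclusion (a sub-multigraph is determined by its vertex set). -/
noncomputable def components [Fintype V] (Γ : Multigraph V) : Finset (Finset V) :=
  Finset.univ.filter fun S => Maximal (fun T => (Γ.induce T).Connected) S

/-- The sum of a finite family of multigraphs on the same vertices. -/
def sum {ι : Type*} [Fintype ι] (Γ : ι → Multigraph V) : Multigraph V where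
  mult e := ∑ i, (Γ i).mult e

/-- The integral of `f` along `Γ`: there is one variable in `[0,1]` for each vertex and one factor
`f (s a) (s b)` for each edge between `a` and `b`. For symmetric `f` the choice of the
representative `(a, b)` of the unordered pair does not matter. -/
noncomputable def integral [Fintype V] [DecidableEq V] (Γ : Multigraph V)
    (f : unitInterval → unitInterval → ℝ) : ℝ :=
  ∫ s : V → unitInterval, ∏ e : Sym2 V, f (s (Quot.out e).1) (s (Quot.out e).2) ^ Γ.mult e

/-- Only finitely many multigraphs have a prescribed degree at every vertex. -/
theorem finite_setOf_degree_eq [Fintype V] [DecidableEq V] (d : V → ℕ) :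
    {Γ : Multigraph V | ∀ v, Γ.degree v = d v}.Finite := by
  classical
  have hfin : (Set.univ.pi fun _ : Sym2 V => Set.Iic (∑ v, d v)).Finite :=
    Set.Finite.pi fun _ => Set.finite_Iic _
  refine Set.Finite.of_finite_image (f := Multigraph.mult) (hfin.subset ?_) ?_
  · rintro _ ⟨Γ, hΓ, rfl⟩ e -
    induction e using Sym2.ind with
    | _ a b =>
      have h1 : Γ.mult s(a, b) ≤ Γ.degree a := by
        unfold degree
        by_cases hab : a = b
        · subst hab; omega
        · have : Γ.mult s(a, b) ≤ ∑ w ∈ Finset.univ.erase a, Γ.mult s(a, w) :=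
            Finset.single_le_sum (f := fun w => Γ.mult s(a, w)) (fun _ _ => Nat.zero_le _)
              (Finset.mem_erase.2 ⟨Ne.symm hab, Finset.mem_univ b⟩)
          omega
      have h2 : d a ≤ ∑ v, d v :=
        Finset.single_le_sum (fun _ _ => Nat.zero_le _) (Finset.mem_univ a)
      exact (h1.trans_eq (hΓ a)).trans h2
  · intro Γ _ Γ' _ h
    exact Multigraph.ext h

/-- The multigraphs on `V` with degree `d v` at every vertex `v`. -/
noncomputable def withDegree [Fintype V] [DecidableEq V] (d : V → ℕ) : Finset (Multigraph V) :=
  (finite_setOf_degree_eq d).toFinset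

/-- The sum of the entries of the `j`-th column plus the sum of those of the `j`-th row. -/
def colRowSum {n : ℕ} (M : Matrix (Fin n) (Fin n) ℕ) (j : Fin n) : ℕ :=
  (∑ i, M i j) + ∑ i, M j i

/-- The combinatorial number `C(M, A)` of a square matrix `M` and a matrix `A` with as many rows:
`∏ (A j k)! / 2 ^ tr M` times the sum of `∏ₖ 1 / ∏ (Mₖ)ᵢⱼ!` over all decompositions
`M = M₁ + ⋯ + Mₗ` such that the `j`-th column and the `j`-th row of `Mₖ` add up to `A j k`. -/
noncomputable def matrixFactor {n l : ℕ} (M : Matrix (Fin n) (Fin n) ℕ)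
    (A : Matrix (Fin n) (Fin l) ℕ) : ℝ :=
  ((∏ j, ∏ k, (A j k).factorial : ℕ) : ℝ) / 2 ^ M.trace *
    ∑ᶠ (N : Fin l → Matrix (Fin n) (Fin n) ℕ)
      (_ : ∑ k, N k = M ∧ ∀ j k, colRowSum (N k) j = A j k),
      ∏ k, 1 / ((∏ i, ∏ j, (N k i j).factorial : ℕ) : ℝ)

/-- The upper triangular adjacency matrix with respect to an enumeration of the vertices. -/
def upperAdj {n : ℕ} (v : Fin n ≃ V) (Γ : Multigraph V) : Matrix (Fin n) (Fin n) ℕ :=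
  Matrix.of fun i j => if i ≤ j then Γ.mult s(v i, v j) else 0

/-- The symmetry factor `C(Γ) = C(M, A)`, where `M` is the upper triangular adjacency matrix and
the only column of `A` consists of the column-plus-row sums of `M`. -/
noncomputable def symmetryFactor {n : ℕ} (v : Fin n ≃ V) (Γ : Multigraph V) : ℝ :=
  matrixFactor (Γ.upperAdj v) (Matrix.of fun j (_ : Fin 1) => colRowSum (Γ.upperAdj v) j)

end Multigraph

/-! Expand each factor `Q (X (s k))` into monomials, so that only mixed moments of a centred
Gaussian vector `Y` are needed. These come from comparing coefficients instead of counting pairings: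
for every real vector `t` the variable `∑ tᵢYᵢ` is a centred Gaussian, hence `E (∑ tᵢYᵢ)^(2p) =
(2p)!/p! · (Var/2)^p`, and both sides are polynomials in `t`.

For the coordinates of the process, `Var/2` is a sum over pairs (component `q`, unordered pair `e`
of vertices) of the covariance times a quadratic monomial, with weight `1` on edges and `1/2` on
loops. In the multinomial expansion of its `p`-th power the exponents form one multigraph per
component; extracting a monomial prescribes the degrees, and the factorials and powers of `1/2` are
exactly the symmetry factors (`integral_prod_pow_coordinates`). Odd moments vanish, and by the
handshake identity no multigraphs then exist.

The expectation is symmetric in the times, so the simplex carries `1/n!` of the integral over the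
cube (`setIntegral_monotone_of_symmetric`). On the cube the product over edges splits into functions
of the disjoint blocks of coordinates given by the components, and Fubini gives the product of
integrals (`integral_prod_edgeValue`). -/

section GaussianMoments

/-! ### Moments of a one-dimensional Gaussian. -/

theorem integral_pow_gaussianReal_eq_iteratedDeriv (v : NNReal) (n : ℕ) :
    ∫ x, x ^ n ∂gaussianReal 0 v =
      iteratedDeriv n (fun t : ℝ => Real.exp (v * t ^ 2 / 2)) 0 := by
  have h := iteratedDeriv_mgf_zero (X := fun x : ℝ => x) (μ := gaussianReal 0 v) (by simp) n
  rw [mgf_fun_id_gaussianReal] at h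
  simp only [zero_mul, zero_add] at h
  rw [h]
  rfl

/-- Leibniz rule applied to `g' = v t g`. At `t = 0` the first term dies, which leaves the two-step
recursion of the moments. -/
theorem iteratedDeriv_exp_sq (v : ℝ) (n : ℕ) :
    iteratedDeriv (n + 2) (fun t : ℝ => Real.exp (v * t ^ 2 / 2)) = fun t =>
      v * (t * iteratedDeriv (n + 1) (fun t : ℝ => Real.exp (v * t ^ 2 / 2)) t +
        (n + 1) * iteratedDeriv n (fun t : ℝ => Real.exp (v * t ^ 2 / 2)) t) := by
  set g : ℝ → ℝ := fun t => Real.exp (v * t ^ 2 / 2) with hg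
  have hsm : ContDiff ℝ ⊤ g := by fun_prop
  have hd : ∀ k, Differentiable ℝ (iteratedDeriv k g) := fun k =>
    hsm.differentiable_iteratedDeriv k (WithTop.coe_lt_top _)
  have h1 : deriv g = fun t => v * (t * g t) := by
    funext t
    have : HasDerivAt g (Real.exp (v * t ^ 2 / 2) * (v * (2 * t) / 2)) t := by
      have := (((hasDerivAt_pow 2 t).const_mul v).div_const 2).exp
      simpa using this
    rw [this.deriv]; simp only [hg]; ring
  have hs : ∀ k t, HasDerivAt (iteratedDeriv k g) (iteratedDeriv (k + 1) g t) t := fun k t => by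
    rw [iteratedDeriv_succ]; exact (hd k t).hasDerivAt
  induction n with
  | zero =>
    funext t
    rw [show (0 + 2) = 1 + 1 from rfl, iteratedDeriv_succ, iteratedDeriv_one]
    conv_lhs => rw [h1]
    have h0 : HasDerivAt g (deriv g t) t := (hsm.differentiable (by simp) t).hasDerivAt
    have := (((hasDerivAt_id t).mul h0).const_mul v).deriv
    refine this.trans ?_
    simp only [iteratedDeriv_zero, h1, id]
    push_cast
    ring
  | succ n ih =>
    funext t
    rw [show n + 1 + 2 = (n + 2) + 1 from rfl, iteratedDeriv_succ]
    conv_lhs => rw [ih]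
    have := ((((hasDerivAt_id t).mul (hs (n + 1) t)).add
      ((hs n t).const_mul ((n : ℝ) + 1))).const_mul v).deriv
    refine this.trans ?_
    push_cast; simp only [id]; ring

theorem integral_pow_add_two_gaussianReal (v : NNReal) (n : ℕ) :
    ∫ x, x ^ (n + 2) ∂gaussianReal 0 v = v * (n + 1) * ∫ x, x ^ n ∂gaussianReal 0 v := by
  simp only [integral_pow_gaussianReal_eq_iteratedDeriv, iteratedDeriv_exp_sq]
  ring

theorem integral_pow_odd_gaussianReal (v : NNReal) (p : ℕ) :
    ∫ x, x ^ (2 * p + 1) ∂gaussianReal 0 v = 0 := by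
  induction p with
  | zero => simp
  | succ p ih =>
    rw [show 2 * (p + 1) + 1 = (2 * p + 1) + 2 by ring, integral_pow_add_two_gaussianReal, ih,
      mul_zero]

theorem integral_pow_even_gaussianReal (v : NNReal) (p : ℕ) :
    ∫ x, x ^ (2 * p) ∂gaussianReal 0 v =
      (2 * p).factorial / p.factorial * ((v : ℝ) / 2) ^ p := by
  induction p with
  | zero => simp
  | succ p ih =>
    rw [show 2 * (p + 1) = 2 * p + 2 by ring, integral_pow_add_two_gaussianReal, ih]
    simp only [Nat.factorial_succ, pow_succ]
    push_cast
    field_simp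
    ring

end GaussianMoments

/-! ### Mixed moments of Gaussian vectors by comparing coefficients. -/

section Wick

variable {Ω : Type*} [MeasurableSpace Ω] {P : Measure Ω}
  {ι : Type*} [Fintype ι] {Y : ι → Ω → ℝ}

/-- The product is dominated by the power `∑ i, d i` of the sup norm, and Gaussian vectors have
moments of every order. -/
theorem ProbabilityTheory.HasGaussianLaw.integrable_prod_pow
    (hY : HasGaussianLaw (fun ω i => Y i ω) P) (d : ι → ℕ) :
    Integrable (fun ω => ∏ i, Y i ω ^ d i) P := by
  have := hY.isProbabilityMeasure
  have hN : MemLp (fun ω i => Y i ω) (∑ i, d i : ℕ) P := hY.memLp (by simp)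
  refine hN.integrable_norm_pow'.mono' ?_ (.of_forall fun ω => ?_)
  · exact (Finset.aemeasurable_fun_prod _ fun i _ =>
      (hY.eval i).aemeasurable.pow_const _).aestronglyMeasurable
  · rw [norm_prod, ← Finset.prod_pow_eq_pow_sum]
    refine Finset.prod_le_prod (fun _ _ => norm_nonneg _) fun i _ => ?_
    rw [norm_pow]
    exact pow_le_pow_left₀ (norm_nonneg _) (norm_le_pi_norm (fun i => Y i ω) i) _

theorem ProbabilityTheory.HasGaussianLaw.integral_linearCombination_pow
    (hY : HasGaussianLaw (fun ω i => Y i ω) P) (t : ι → ℝ) (N : ℕ) [DecidableEq ι] :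
    ∫ ω, (∑ i, t i * Y i ω) ^ N ∂P = ∑ k ∈ Finset.piAntidiag Finset.univ N,
      (Nat.multinomial Finset.univ k * ∫ ω, ∏ i, Y i ω ^ k i ∂P) * ∏ i, t i ^ k i := by
  simp_rw [Finset.sum_pow_eq_sum_piAntidiag, mul_pow, Finset.prod_mul_distrib]
  rw [integral_finsetSum]
  · refine Finset.sum_congr rfl fun k _ => ?_
    rw [integral_const_mul, integral_const_mul]; ring
  · intro k _
    exact ((hY.integrable_prod_pow k).const_mul _).const_mul _

theorem ProbabilityTheory.HasGaussianLaw.map_linearCombination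
    (hY : HasGaussianLaw (fun ω i => Y i ω) P) (hmean : ∀ i, ∫ ω, Y i ω ∂P = 0) (t : ι → ℝ) :
    P.map (fun ω => ∑ i, t i * Y i ω) =
      gaussianReal 0 (Var[fun ω => ∑ i, t i * Y i ω; P]).toNNReal := by
  have hL : HasGaussianLaw (fun ω => ∑ i, t i * Y i ω) P := by
    have := hY.map_fun (∑ i, t i • ContinuousLinearMap.proj (R := ℝ) (φ := fun _ : ι => ℝ) i)
    simpa using this
  rw [hL.map_eq_gaussianReal]
  congr 1
  rw [integral_finsetSum]
  · simp [integral_const_mul, hmean]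
  · exact fun i _ => (hY.eval i).integrable.const_mul _

theorem ProbabilityTheory.HasGaussianLaw.integral_linearCombination_pow_eq
    (hY : HasGaussianLaw (fun ω i => Y i ω) P) (hmean : ∀ i, ∫ ω, Y i ω ∂P = 0) (t : ι → ℝ)
    (N : ℕ) :
    ∫ ω, (∑ i, t i * Y i ω) ^ N ∂P =
      ∫ x, x ^ N ∂gaussianReal 0 (Var[fun ω => ∑ i, t i * Y i ω; P]).toNNReal := by
  rw [← hY.map_linearCombination hmean, integral_map]
  · exact Finset.aemeasurable_fun_sum _ fun i _ => (hY.eval i).aemeasurable.const_mul _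
  · fun_prop

/-- Coefficients of two polynomial functions written as sums over possibly repeated monomials. -/
theorem sum_filter_eq_of_forall_sum_mul_prod_pow_eq {A B : Type*} [DecidableEq ι]
    (s : Finset A) (a : A → ℝ) (u : A → ι → ℕ) (s' : Finset B) (b : B → ℝ) (w : B → ι → ℕ)
    (h : ∀ t : ι → ℝ, ∑ k ∈ s, a k * ∏ i, t i ^ u k i = ∑ k ∈ s', b k * ∏ i, t i ^ w k i)
    (d : ι → ℕ) :
    ∑ k ∈ s with u k = d, a k = ∑ k ∈ s' with w k = d, b k := by
  have key : (∑ k ∈ s, MvPolynomial.monomial (Finsupp.equivFunOnFinite.symm (u k)) (a k)) =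
      ∑ k ∈ s', MvPolynomial.monomial (Finsupp.equivFunOnFinite.symm (w k)) (b k) := by
    -- Over the infinite field `ℝ`, polynomials with the same values are equal.
    refine MvPolynomial.funext fun t => ?_
    simpa [MvPolynomial.eval_monomial, Finsupp.prod_fintype] using h t
  have := congrArg (MvPolynomial.coeff (Finsupp.equivFunOnFinite.symm d)) key
  simpa [MvPolynomial.coeff_sum, MvPolynomial.coeff_monomial, Finset.sum_filter] using this

/-- Joint moments of a centred Gaussian vector, when the covariance form is written as
`2 * ∑ e, c e * t ^ D e` with quadratic monomials `t ^ D e`. -/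
theorem ProbabilityTheory.HasGaussianLaw.integral_prod_pow [DecidableEq ι]
    (hY : HasGaussianLaw (fun ω i => Y i ω) P) (hmean : ∀ i, ∫ ω, Y i ω ∂P = 0)
    {E : Type*} [Fintype E] [DecidableEq E] (c : E → ℝ) (D : E → ι → ℕ)
    (hvar : ∀ t : ι → ℝ,
      Var[fun ω => ∑ i, t i * Y i ω; P] = 2 * ∑ e, c e * ∏ i, t i ^ D e i)
    (d : ι → ℕ) (p : ℕ) (hd : ∑ i, d i = 2 * p) :
    ∫ ω, ∏ i, Y i ω ^ d i ∂P = (∏ i, ((d i).factorial : ℝ)) *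
      ∑ h ∈ Finset.piAntidiag (Finset.univ : Finset E) p with (fun i => ∑ e, h e * D e i) = d,
        ∏ e, c e ^ h e / (h e).factorial := by
  -- Two expansions of `E (∑ tᵢYᵢ)^(2p)`: expand the power under the expectation, or expand
  -- `(Var/2)^p` in the closed formula. The `p!` there cancels against the multinomial coefficients
  -- of `h`.
  have key := sum_filter_eq_of_forall_sum_mul_prod_pow_eq
    (Finset.piAntidiag (Finset.univ : Finset ι) (2 * p))
    (fun k => Nat.multinomial Finset.univ k * ∫ ω, ∏ i, Y i ω ^ k i ∂P) id
    (Finset.piAntidiag (Finset.univ : Finset E) p)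
    (fun h => (2 * p).factorial * ∏ e, c e ^ h e / (h e).factorial)
    (fun h i => ∑ e, h e * D e i) (fun t => ?_) d
  · rw [← Finset.mul_sum] at key
    have hf : (Finset.piAntidiag (Finset.univ : Finset ι) (2 * p)).filter (fun k => id k = d) =
        {d} := by
      ext k; simp only [Finset.mem_filter, Finset.mem_piAntidiag, id, Finset.mem_singleton]
      constructor
      · exact fun h => h.2
      · rintro rfl; simp [hd]
    rw [hf, Finset.sum_singleton, ← hd, ← Nat.multinomial_spec] at key
    have hpos : (Nat.multinomial Finset.univ d : ℝ) ≠ 0 := by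
      exact_mod_cast (Nat.multinomial_pos _ _).ne'
    push_cast at key
    refine mul_left_cancel₀ hpos ?_
    rw [key]; ring
  · simp only [id]
    rw [← hY.integral_linearCombination_pow, hY.integral_linearCombination_pow_eq hmean,
      integral_pow_even_gaussianReal, Real.coe_toNNReal _ (variance_nonneg _ _), hvar,
      mul_div_cancel_left₀ _ (two_ne_zero), Finset.sum_pow_eq_sum_piAntidiag, Finset.mul_sum]
    refine Finset.sum_congr rfl fun h hh => ?_
    have hsum : ∑ e, h e = p := (Finset.mem_piAntidiag.1 hh).1
    have hms := Nat.multinomial_spec Finset.univ h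
    rw [hsum] at hms
    have h1 : ∏ e, (c e * ∏ i, t i ^ D e i) ^ h e =
        (∏ e, c e ^ h e) * ∏ i, t i ^ ∑ e, h e * D e i := by
      simp_rw [mul_pow, Finset.prod_mul_distrib, ← Finset.prod_pow, ← pow_mul]
      rw [Finset.prod_comm]
      simp_rw [Finset.prod_pow_eq_pow_sum, mul_comm (h _)]
    rw [h1, ← hms, Finset.prod_div_distrib]
    have : (∏ e, ((h e).factorial : ℝ)) ≠ 0 :=
      Finset.prod_ne_zero_iff.2 fun e _ => by exact_mod_cast (Nat.factorial_pos _).ne'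
    have : (Nat.multinomial Finset.univ h : ℝ) ≠ 0 := by
      exact_mod_cast (Nat.multinomial_pos _ _).ne'
    push_cast
    field_simp

theorem ProbabilityTheory.HasGaussianLaw.integral_prod_pow_eq_zero_of_odd [DecidableEq ι]
    (hY : HasGaussianLaw (fun ω i => Y i ω) P) (hmean : ∀ i, ∫ ω, Y i ω ∂P = 0)
    (d : ι → ℕ) (hd : Odd (∑ i, d i)) :
    ∫ ω, ∏ i, Y i ω ^ d i ∂P = 0 := by
  obtain ⟨p, hp⟩ := hd
  have key := sum_filter_eq_of_forall_sum_mul_prod_pow_eq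
    (Finset.piAntidiag (Finset.univ : Finset ι) (2 * p + 1))
    (fun k => Nat.multinomial Finset.univ k * ∫ ω, ∏ i, Y i ω ^ k i ∂P) id
    -- The odd moment is the zero polynomial in `t`, written as an empty sum.
    (∅ : Finset Unit) (fun _ => 0) (fun _ _ => 0) (fun t => ?_) d
  · have hf : (Finset.piAntidiag (Finset.univ : Finset ι) (2 * p + 1)).filter
        (fun k => id k = d) = {d} := by
      ext k; simp only [Finset.mem_filter, Finset.mem_piAntidiag, id, Finset.mem_singleton]
      constructor
      · exact fun h => h.2
      · rintro rfl; simp [hp]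
    rw [hf, Finset.sum_singleton] at key
    simpa [(Nat.multinomial_pos _ _).ne'] using key
  · simp only [id]
    rw [← hY.integral_linearCombination_pow, hY.integral_linearCombination_pow_eq hmean,
      integral_pow_odd_gaussianReal]
    simp

end Wick

/-! ### Connected components and the splitting of the edge product. -/

namespace Multigraph

variable {V : Type*}

theorem reflTransGen_of_connected_induce {Γ : Multigraph V} {S T : Finset V} (hST : S ⊆ T)
    (hS : (Γ.induce S).Connected) {a b : T} (ha : a.1 ∈ S) (hb : b.1 ∈ S) :
    Relation.ReflTransGen (fun x y => 1 ≤ (Γ.induce T).mult s(x, y)) a b := by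
  by_cases hab : a = b
  · rw [hab]
  · have h := hS ⟨a, ha⟩ ⟨b, hb⟩ fun h => hab (Subtype.ext (congrArg (fun x : S => x.1) h))
    exact (h.lift (p := fun x y => 1 ≤ (Γ.induce T).mult s(x, y))
      (fun x : S => (⟨x.1, hST x.2⟩ : T)) (fun x y hxy => hxy)).to_reflTransGen

/-- The common vertex `x` is a hub: every chain is routed through it. -/
theorem connected_induce_union [DecidableEq V] {Γ : Multigraph V} {S T : Finset V}
    (hS : (Γ.induce S).Connected) (hT : (Γ.induce T).Connected) {x : V} (hxS : x ∈ S)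
    (hxT : x ∈ T) : (Γ.induce (S ∪ T)).Connected := by
  intro a b hab
  let x' : (S ∪ T : Finset V) := ⟨x, Finset.mem_union_left _ hxS⟩
  have h1 : ∀ c : (S ∪ T : Finset V),
      Relation.ReflTransGen (fun x y => 1 ≤ (Γ.induce (S ∪ T)).mult s(x, y)) c x' ∧
      Relation.ReflTransGen (fun x y => 1 ≤ (Γ.induce (S ∪ T)).mult s(x, y)) x' c := by
    intro c
    rcases Finset.mem_union.1 c.2 with h | h
    · exact ⟨reflTransGen_of_connected_induce Finset.subset_union_left hS h hxS,
        reflTransGen_of_connected_induce Finset.subset_union_left hS hxS h⟩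
    · exact ⟨reflTransGen_of_connected_induce Finset.subset_union_right hT h hxT,
        reflTransGen_of_connected_induce Finset.subset_union_right hT hxT h⟩
  rcases Relation.reflTransGen_iff_eq_or_transGen.1 ((h1 a).1.trans (h1 b).2) with h | h
  · exact absurd h.symm hab
  · exact h

/-- The value `f (s a) (s b)` on the edge `s(a, b)`, for symmetric `f`. -/
noncomputable def edgeValue {W I : Type*} (f : I → I → ℝ) (s : W → I) (e : Sym2 W) : ℝ :=
  f (s (Quot.out e).1) (s (Quot.out e).2)

/-- `Quot.out` may return either orientation of the pair; symmetry of `f` makes this harmless. -/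
theorem edgeValue_mk {I : Type*} {f : I → I → ℝ} (hf : ∀ x y, f x y = f y x) (s : V → I)
    (a b : V) : edgeValue f s s(a, b) = f (s a) (s b) := by
  have h : s((Quot.out s(a, b)).1, (Quot.out s(a, b)).2) = s(a, b) := Quot.out_eq _
  rcases Sym2.eq_iff.1 h with ⟨h1, h2⟩ | ⟨h1, h2⟩
  · rw [edgeValue, h1, h2]
  · rw [edgeValue, h1, h2, hf]

theorem edgeValue_map {W I : Type*} {f : I → I → ℝ} (hf : ∀ x y, f x y = f y x) (s : V → I)
    (g : W → V) (e : Sym2 W) : edgeValue f s (e.map g) = edgeValue f (s ∘ g) e := by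
  induction e using Sym2.ind with
  | _ a b => rw [Sym2.map_mk, edgeValue_mk hf, edgeValue_mk hf]; rfl

theorem continuous_edgeValue {I : Type*} [TopologicalSpace I] {f : I → I → ℝ}
    (hf : Continuous (Function.uncurry f)) (e : Sym2 V) :
    Continuous fun s : V → I => edgeValue f s e := by
  have h : Continuous fun s : V → I => (s (Quot.out e).1, s (Quot.out e).2) := by fun_prop
  exact hf.comp h

variable [Fintype V]

theorem mem_components {Γ : Multigraph V} {S : Finset V} :
    S ∈ Γ.components ↔ Maximal (fun T => (Γ.induce T).Connected) S := by
  simp [components]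

/-- Two maximal connected sets that share a vertex both equal their union, which is connected. -/
theorem pairwiseDisjoint_components (Γ : Multigraph V) :
    (Γ.components : Set (Finset V)).PairwiseDisjoint id := by
  classical
  intro S hS T hT hne
  rw [Function.onFun, id, id, Finset.disjoint_left]
  intro x hxS hxT
  have hS' := mem_components.1 (Finset.mem_coe.1 hS)
  have hT' := mem_components.1 (Finset.mem_coe.1 hT)
  have hU := connected_induce_union hS'.prop hT'.prop hxS hxT
  exact hne ((hS'.eq_of_le hU Finset.subset_union_left).trans
    (hT'.eq_of_le hU Finset.subset_union_right).symm)

/-- The endpoints of an edge form a connected set, which by finiteness lies in a maximal one. -/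
theorem exists_mem_components_of_mult_ne_zero [DecidableEq V] {Γ : Multigraph V} {e : Sym2 V}
    (he : Γ.mult e ≠ 0) : ∃ S ∈ Γ.components, e ∈ S.sym2 := by
  induction e using Sym2.ind with
  | _ a b =>
    have hc : (Γ.induce {a, b}).Connected := by
      rintro ⟨x, hx⟩ ⟨y, hy⟩ hxy
      refine Relation.TransGen.single ?_
      have hxy' : x ≠ y := fun h => hxy (Subtype.ext h)
      have : s(x, y) = s(a, b) := by
        simp only [Finset.mem_insert, Finset.mem_singleton] at hx hy
        rw [Sym2.eq_iff]
        rcases hx with rfl | rfl <;> rcases hy with rfl | rfl <;> simp_all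
      change 1 ≤ Γ.mult s(x, y)
      rw [this]; omega
    obtain ⟨S, hle, hS⟩ := Finite.exists_le_maximal
      (p := fun T => (Γ.induce T).Connected) hc
    refine ⟨S, mem_components.2 hS, ?_⟩
    rw [Finset.mk_mem_sym2_iff]
    exact ⟨hle (by simp), hle (by simp)⟩

/-- An edge of positive multiplicity lies in exactly one component; every other pair contributes a
zeroth power. -/
theorem prod_edgeValue_eq_prod_components [DecidableEq V] {I : Type*} {f : I → I → ℝ}
    (hf : ∀ x y, f x y = f y x) (Γ : Multigraph V) (s : V → I) :
    ∏ e, edgeValue f s e ^ Γ.mult e = ∏ S ∈ Γ.components,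
      ∏ e : Sym2 S, edgeValue f (S.restrict s) e ^ (Γ.induce S).mult e := by
  have h1 : ∀ S : Finset V,
      ∏ e : Sym2 S, edgeValue f (S.restrict s) e ^ (Γ.induce S).mult e =
        ∏ e ∈ S.sym2, edgeValue f s e ^ Γ.mult e := by
    intro S
    refine Finset.prod_bij (fun e _ => e.map Subtype.val) ?_ ?_ ?_ ?_
    · intro e _
      induction e using Sym2.ind with
      | _ a b => simp
    · intro e _ e' _ h
      exact Sym2.map.injective Subtype.val_injective h
    · intro e he
      induction e using Sym2.ind with
      | _ a b =>
        rw [Finset.mk_mem_sym2_iff] at he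
        exact ⟨s(⟨a, he.1⟩, ⟨b, he.2⟩), Finset.mem_univ _, rfl⟩
    · intro e _
      rw [edgeValue_map hf]; rfl
  simp_rw [h1]
  rw [← Finset.prod_biUnion]
  · refine (Finset.prod_subset (Finset.subset_univ _) fun e _ he => ?_).symm
    by_cases h : Γ.mult e = 0
    · simp [h]
    · obtain ⟨S, hS, heS⟩ := exists_mem_components_of_mult_ne_zero h
      exact absurd (Finset.mem_biUnion.2 ⟨S, hS, heS⟩) he
  · intro S hS T hT hne
    have hd := pairwiseDisjoint_components Γ hS hT hne
    rw [Function.onFun, Finset.disjoint_left]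
    intro e heS heT
    induction e using Sym2.ind with
    | _ a b =>
      rw [Finset.mk_mem_sym2_iff] at heS heT
      exact Finset.disjoint_left.1 hd heS.1 heT.1

end Multigraph

/-! ### Integrals of products over disjoint blocks of coordinates. -/

section ProductIntegral

variable {V I : Type*} [Fintype V] [MeasurableSpace I] (μ : Measure I) [IsProbabilityMeasure μ]

theorem integral_comp_finset_restrict (S : Finset V) (g : (S → I) → ℝ) (hg : Measurable g) :
    ∫ s, g (S.restrict s) ∂Measure.pi (fun _ : V => μ) = ∫ s, g s ∂Measure.pi fun _ : S => μ := by
  rw [← Measure.infinitePi_eq_pi, integral_restrict_infinitePi]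
  exact hg.aestronglyMeasurable

/-- Functions of disjoint blocks of coordinates are integrated separately. -/
theorem integral_prod_comp_finset_restrict (C : Finset (Finset V))
    (hC : (C : Set (Finset V)).PairwiseDisjoint id) (g : ∀ S : Finset V, (S → I) → ℝ)
    (hg : ∀ S, Measurable (g S)) :
    ∫ s, ∏ S ∈ C, g S (S.restrict s) ∂Measure.pi (fun _ : V => μ) =
      ∏ S ∈ C, ∫ s, g S s ∂Measure.pi fun _ : S => μ := by
  classical
  induction C using Finset.induction_on with
  | empty => simp
  | insert S C hSC ih =>
    rw [Finset.coe_insert, Set.pairwiseDisjoint_insert] at hC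
    rw [Finset.prod_insert hSC, ← ih hC.1, ← integral_comp_finset_restrict μ S _ (hg S)]
    simp_rw [Finset.prod_insert hSC]
    have hdisj : Disjoint S (C.biUnion id) := by
      rw [Finset.disjoint_biUnion_right]
      exact fun T hT => hC.2 T hT fun h => hSC (h ▸ hT)
    -- Coordinates are independent under the product measure, so the block `S` is independent of the
    -- union of the other blocks.
    have hind := (iIndepFun_pi (μ := fun _ : V => μ) (X := fun _ x => x)
      fun _ => aemeasurable_id).indepFun_finset S (C.biUnion id) hdisj
      fun i => measurable_pi_apply i
    let G : (↥(C.biUnion id) → I) → ℝ := fun x => ∏ T ∈ C.attach,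
      g T.1 fun w => x ⟨w, Finset.mem_biUnion.2 ⟨T, T.2, w.2⟩⟩
    have hG : Measurable G := Finset.measurable_fun_prod _ fun T _ => (hg T.1).comp
      (measurable_pi_lambda _ fun w => measurable_pi_apply _)
    have hGs : ∀ s : V → I, ∏ T ∈ C, g T (T.restrict s) = G ((C.biUnion id).restrict s) :=
      fun s => (Finset.prod_attach C fun T => g T (T.restrict s)).symm
    simp_rw [hGs]
    exact (hind.comp (hg S) hG).integral_fun_mul_eq_mul_integral
      ((hg S).comp (Finset.measurable_restrict S)).aestronglyMeasurable
      (hG.comp (Finset.measurable_restrict _)).aestronglyMeasurable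

end ProductIntegral

namespace Multigraph

variable {V : Type*} [Fintype V] [DecidableEq V]

theorem integral_prod_edgeValue {f : unitInterval → unitInterval → ℝ}
    (hf : ∀ x y, f x y = f y x) (hfc : Continuous (Function.uncurry f)) (Γ : Multigraph V) :
    ∫ s : V → unitInterval, ∏ e, edgeValue f s e ^ Γ.mult e =
      ∏ S ∈ Γ.components, (Γ.induce S).integral f := by
  rw [funext (prod_edgeValue_eq_prod_components hf Γ)]
  refine integral_prod_comp_finset_restrict volume Γ.components Γ.pairwiseDisjoint_components
    (fun S s => ∏ e : Sym2 S, edgeValue f s e ^ (Γ.induce S).mult e) fun S => ?_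
  exact (continuous_finsetProd _ fun e _ => (continuous_edgeValue hfc e).pow _).measurable

end Multigraph

theorem finsum_eq_of_unique {A : Type*} {p : A → Prop} {g : A → ℝ} (a : A) (ha : p a)
    (huniq : ∀ b, p b → b = a) : ∑ᶠ (b : A) (_ : p b), g b = g a := by
  obtain rfl : p = fun b => b = a := funext fun b => propext ⟨huniq b, fun h => h ▸ ha⟩
  exact finsum_mem_singleton

/-! ### Sums over unordered pairs, degrees and symmetry factors. -/

section Sym2Sums

variable {V : Type*} [Fintype V]

theorem prod_prod_le_sym2_mk {n : ℕ} (v : Fin n ≃ V) (g : Sym2 V → ℕ) :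
    ∏ i, ∏ j, (if i ≤ j then g s(v i, v j) else 1) = ∏ e, g e := by
  rw [← Finset.prod_product', Finset.univ_product_univ, ← Finset.prod_filter]
  refine Finset.prod_bij (fun p _ => s(v p.1, v p.2)) ?_ ?_ ?_ ?_
  · simp
  · rintro ⟨a, b⟩ hab ⟨c, d⟩ hcd h
    simp only [Finset.mem_filter, Finset.mem_univ, true_and] at hab hcd
    simp only [Sym2.eq_iff, v.injective.eq_iff] at h
    rcases h with ⟨rfl, rfl⟩ | ⟨rfl, rfl⟩
    · rfl
    · rw [le_antisymm hab hcd]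
  · intro e _
    induction e using Sym2.ind with
    | _ a b =>
      rcases le_total (v.symm a) (v.symm b) with h | h
      · exact ⟨(v.symm a, v.symm b), by simpa using h, by simp⟩
      · exact ⟨(v.symm b, v.symm a), by simpa using h, by simp⟩
  · simp

variable [DecidableEq V]

/-- Two ordered pairs lie over an edge, one over a loop. Halving the variance turns these counts
into the weights `1` and `1/2`. -/
theorem sum_sum_sym2_mk (g : Sym2 V → ℝ) :
    ∑ a, ∑ b, g s(a, b) = ∑ e : Sym2 V, (if e.IsDiag then 1 else 2) * g e := by
  rw [← Finset.sum_product', Finset.univ_product_univ,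
    ← Finset.sum_fiberwise Finset.univ (fun p : V × V => s(p.1, p.2))]
  refine Finset.sum_congr rfl fun e _ => ?_
  induction e using Sym2.ind with
  | _ a b =>
    have h : (Finset.univ.filter fun p : V × V => s(p.1, p.2) = s(a, b)) = {(a, b), (b, a)} := by
      ext ⟨x, y⟩; simp
    rw [h]
    by_cases hab : a = b
    · simp [hab]
    · rw [Finset.sum_pair (by simpa using fun h _ => hab h)]
      simp only [Sym2.mk_isDiag_iff, hab, if_false]
      rw [Sym2.eq_swap]; ring

theorem sum_ite_isDiag (g : Sym2 V → ℕ) :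
    ∑ e : Sym2 V, (if e.IsDiag then g e else 0) = ∑ w, g s(w, w) := by
  rw [← Finset.sum_filter]
  refine (Finset.sum_bij (fun w _ => s(w, w)) ?_ ?_ ?_ ?_).symm
  · simp
  · intro a _ b _ h; simpa using h
  · intro e he
    induction e using Sym2.ind with
    | _ a b =>
      obtain rfl : a = b := by simpa using he
      exact ⟨a, Finset.mem_univ _, rfl⟩
  · simp

/-- The number of times that `w` is an endpoint of `e`: two if `e` is the loop at `w`. -/
def endpointCount (e : Sym2 V) (w : V) : ℕ :=
  ∑ x, if s(w, x) = e then (if x = w then 2 else 1) else 0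

theorem endpointCount_mk (a b w : V) :
    endpointCount s(a, b) w = (if w = a then 1 else 0) + if w = b then 1 else 0 := by
  unfold endpointCount
  by_cases ha : w = a
  · subst ha
    simp only [Sym2.congr_right, Finset.sum_ite_eq', Finset.mem_univ, if_true]
    by_cases hb : w = b
    · simp [hb]
    · simp [hb, Ne.symm hb]
  · by_cases hb : w = b
    · subst hb
      rw [Sym2.eq_swap]
      simp [ha, Ne.symm ha]
    · have : ∀ x, s(w, x) ≠ s(a, b) := by
        intro x h
        rcases Sym2.eq_iff.1 h with ⟨h, -⟩ | ⟨h, -⟩ <;> contradiction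
      simp [this, ha, hb]

theorem sum_endpointCount (e : Sym2 V) : ∑ w, endpointCount e w = 2 := by
  induction e using Sym2.ind with
  | _ a b => simp [endpointCount_mk, Finset.sum_add_distrib]

theorem prod_pow_endpointCount (t : V → ℝ) (a b : V) :
    ∏ w, t w ^ endpointCount s(a, b) w = t a * t b := by
  simp_rw [endpointCount_mk, pow_add, Finset.prod_mul_distrib]
  simp [pow_ite]

end Sym2Sums

namespace Multigraph

variable {V : Type*} [Fintype V] [DecidableEq V]

theorem degree_eq_sum_endpointCount (Γ : Multigraph V) (w : V) :
    Γ.degree w = ∑ e, Γ.mult e * endpointCount e w := by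
  unfold degree endpointCount
  simp_rw [Finset.mul_sum]
  rw [Finset.sum_comm, ← Finset.add_sum_erase _ _ (Finset.mem_univ w)]
  congr 1
  · simp [mul_comm]
  · refine Finset.sum_congr rfl fun x hx => ?_
    simp [Finset.ne_of_mem_erase hx]

theorem sum_degree (Γ : Multigraph V) : ∑ w, Γ.degree w = 2 * ∑ e, Γ.mult e := by
  simp_rw [degree_eq_sum_endpointCount]
  rw [Finset.sum_comm]
  simp_rw [← Finset.mul_sum, sum_endpointCount]
  rw [← Finset.sum_mul, mul_comm]

theorem mem_withDegree {Γ : Multigraph V} {d : V → ℕ} :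
    Γ ∈ withDegree d ↔ ∀ w, Γ.degree w = d w := by
  simp [withDegree]

/-- Handshake identity; it rules out families of multigraphs with odd total degree. -/
theorem sum_sum_eq_of_mem_piFinset_withDegree {ι : Type*} [Fintype ι] [DecidableEq ι]
    {d : ι → V → ℕ} {Γ : ι → Multigraph V} (hΓ : Γ ∈ Fintype.piFinset fun q => withDegree (d q)) :
    ∑ q, ∑ w, d q w = 2 * ∑ q, ∑ e, (Γ q).mult e := by
  rw [Finset.mul_sum]
  refine Finset.sum_congr rfl fun q _ => ?_
  rw [← sum_degree]
  exact Finset.sum_congr rfl fun w _ =>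
    (mem_withDegree.1 (Fintype.mem_piFinset.1 hΓ q) w).symm

theorem colRowSum_upperAdj {n : ℕ} (v : Fin n ≃ V) (Γ : Multigraph V) (j : Fin n) :
    colRowSum (Γ.upperAdj v) j = Γ.degree (v j) := by
  have h : ∑ w ∈ Finset.univ.erase (v j), Γ.mult s(v j, w) =
      ∑ i ∈ Finset.univ.erase j, Γ.mult s(v j, v i) := by
    refine (Finset.sum_bij (fun i _ => v i) ?_ ?_ ?_ ?_).symm
    · simp
    · intro a _ b _ h; exact v.injective h
    · intro w hw
      refine ⟨v.symm w, ?_, by simp⟩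
      simp only [Finset.mem_erase, Finset.mem_univ, and_true] at hw ⊢
      rintro rfl; simp at hw
    · simp
  unfold colRowSum upperAdj degree
  rw [h, ← Finset.sum_add_distrib, ← Finset.add_sum_erase _ _ (Finset.mem_univ j)]
  congr 1
  · simp; ring
  · refine Finset.sum_congr rfl fun i hi => ?_
    have hij := Finset.ne_of_mem_erase hi
    rcases lt_or_gt_of_ne hij with h | h
    · simp [h.le, not_le.2 h, Sym2.eq_swap]
    · simp [h.le, not_le.2 h]

theorem symmetryFactor_eq {n : ℕ} (v : Fin n ≃ V) (Γ : Multigraph V) :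
    Γ.symmetryFactor v = (∏ w, ((Γ.degree w).factorial : ℝ)) *
      ((1 / 2) ^ (∑ w, Γ.mult s(w, w)) / ∏ e, ((Γ.mult e).factorial : ℝ)) := by
  unfold symmetryFactor matrixFactor
  have hfin : (∑ᶠ (N : Fin 1 → Matrix (Fin n) (Fin n) ℕ)
      (_ : ∑ k, N k = Γ.upperAdj v ∧ ∀ j k, colRowSum (N k) j =
        Matrix.of (fun j (_ : Fin 1) => colRowSum (Γ.upperAdj v) j) j k),
      ∏ k, 1 / ((∏ i, ∏ j, (N k i j).factorial : ℕ) : ℝ)) =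
      1 / ((∏ i, ∏ j, (Γ.upperAdj v i j).factorial : ℕ) : ℝ) := by
    -- With a single column, the only decomposition of the matrix is the matrix itself.
    refine (finsum_eq_of_unique (fun _ => Γ.upperAdj v) (by simp) fun N h => ?_).trans
      (by simp)
    funext k
    rw [Subsingleton.elim k 0]
    simpa using h.1
  rw [hfin]
  have h1 : ∏ i, ∏ j, (Γ.upperAdj v i j).factorial = ∏ e, (Γ.mult e).factorial := by
    rw [← prod_prod_le_sym2_mk v]
    refine Finset.prod_congr rfl fun i _ => Finset.prod_congr rfl fun j _ => ?_
    simp only [upperAdj, Matrix.of_apply]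
    split_ifs <;> simp
  have h2 : (Γ.upperAdj v).trace = ∑ w, Γ.mult s(w, w) := by
    rw [← Equiv.sum_comp v]
    simp [Matrix.trace, upperAdj]
  have h3 : ∏ j, ∏ k : Fin 1, (Matrix.of (fun j (_ : Fin 1) => colRowSum (Γ.upperAdj v) j)
      j k).factorial = ∏ w, (Γ.degree w).factorial := by
    rw [← Equiv.prod_comp v]
    simp [colRowSum_upperAdj]
  rw [h1, h2, h3]
  push_cast
  rw [one_div, one_div, inv_pow]
  ring

end Multigraph

/-! ### Moments of the coordinates of the process as sums over multigraphs. -/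

section CoordinateMoments

open Multigraph

variable {Ω : Type*} [MeasurableSpace Ω] {P : Measure Ω}
  {T : Type*} {m : ℕ} {X : T → Ω → Fin m → ℝ} {V : Type*} [Fintype V]

/-- The vector is a linear image of the process at the finite set of times taken by `s`; repeated
times are allowed. -/
theorem ProbabilityTheory.IsGaussianProcess.hasGaussianLaw_coordinates
    (hX : IsGaussianProcess X P) (s : V → T) :
    HasGaussianLaw (fun ω (i : Fin m × V) => X (s i.2) ω i.1) P := by
  classical
  have h := (hX.hasGaussianLaw (Finset.univ.image s)).map_fun
    (ContinuousLinearMap.pi fun i : Fin m × V =>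
      (ContinuousLinearMap.proj (R := ℝ) (φ := fun _ : Fin m => ℝ) i.1).comp
        (ContinuousLinearMap.proj (R := ℝ)
          (φ := fun _ : (Finset.univ.image s : Finset T) => Fin m → ℝ)
          ⟨s i.2, Finset.mem_image_of_mem s (Finset.mem_univ i.2)⟩))
  exact h

variable {f : T → T → ℝ}

theorem variance_linearCombination_coordinates [DecidableEq V] [IsProbabilityMeasure P]
    (hX : IsGaussianProcess X P)
    (hcov : ∀ s t i j,
      covariance (fun ω => X s ω i) (fun ω => X t ω j) P = if i = j then f s t else 0)
    (hf : ∀ x y, f x y = f y x) (s : V → T) (t : Fin m × V → ℝ) :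
    Var[fun ω => ∑ i, t i * X (s i.2) ω i.1; P] = 2 * ∑ e : Fin m × Sym2 V,
      ((if e.2.IsDiag then 1 / 2 else 1) * edgeValue f s e.2) *
        ∏ i : Fin m × V, t i ^ (if i.1 = e.1 then endpointCount e.2 i.2 else 0) := by
  have hY := hX.hasGaussianLaw_coordinates s
  rw [variance_fun_sum fun i => (hY.eval i).memLp_two.const_mul (t i)]
  have h1 : ∀ i j : Fin m × V, covariance (fun ω => t i * X (s i.2) ω i.1)
      (fun ω => t j * X (s j.2) ω j.1) P =
      if i.1 = j.1 then t i * t j * f (s i.2) (s j.2) else 0 := by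
    intro i j
    rw [covariance_const_mul_left, covariance_const_mul_right, hcov]
    split_ifs <;> ring
  simp_rw [h1, Fintype.sum_prod_type]
  simp only [Fintype.prod_prod_type]
  rw [Finset.mul_sum]
  refine Finset.sum_congr rfl fun q _ => ?_
  have h2 : ∀ e : Sym2 V, ∏ q', ∏ w, t (q', w) ^
      (if q' = q then endpointCount e w else 0) = ∏ w, t (q, w) ^ endpointCount e w := by
    intro e
    rw [Finset.prod_eq_single q]
    · simp
    · intro q' _ h; simp [h]
    · simp
  simp_rw [h2]
  have h3 := sum_sum_sym2_mk fun e : Sym2 V =>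
    edgeValue f s e * ∏ w, t (q, w) ^ endpointCount e w
  have h4 : ∀ a b, ∏ w, t (q, w) ^ endpointCount s(a, b) w = t (q, a) * t (q, b) :=
    fun a b => prod_pow_endpointCount (fun w => t (q, w)) a b
  simp_rw [edgeValue_mk hf, h4] at h3
  rw [Finset.mul_sum]
  refine Eq.trans ?_ (h3.trans ?_)
  · refine Finset.sum_congr rfl fun a _ => ?_
    rw [Finset.sum_comm]
    refine Finset.sum_congr rfl fun b _ => ?_
    simp [mul_comm]
  · refine Finset.sum_congr rfl fun e _ => ?_
    split_ifs <;> ring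

/-- The joint moments of a centred Gaussian process with independent identically distributed
components, as a sum over multigraphs with prescribed degrees. -/
theorem integral_prod_pow_coordinates [DecidableEq V] [IsProbabilityMeasure P]
    (hX : IsGaussianProcess X P) (hmean : ∀ s i, ∫ ω, X s ω i ∂P = 0)
    (hcov : ∀ s t i j,
      covariance (fun ω => X s ω i) (fun ω => X t ω j) P = if i = j then f s t else 0)
    (hf : ∀ x y, f x y = f y x) {n : ℕ} (v : Fin n ≃ V) (s : V → T) (d : Fin m → V → ℕ) :
    ∫ ω, ∏ i : Fin m × V, X (s i.2) ω i.1 ^ d i.1 i.2 ∂P =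
      ∑ Γ ∈ Fintype.piFinset fun q => withDegree (d q),
        (∏ q, (Γ q).symmetryFactor v) * ∏ e, edgeValue f s e ^ (Multigraph.sum Γ).mult e := by
  have hY := hX.hasGaussianLaw_coordinates s
  have hmean' : ∀ i : Fin m × V, ∫ ω, X (s i.2) ω i.1 ∂P = 0 := fun i => hmean _ _
  have hdeg : ∀ Γ ∈ Fintype.piFinset fun q => withDegree (d q),
      ∑ i : Fin m × V, d i.1 i.2 = 2 * ∑ q, ∑ e, (Γ q).mult e := by
    intro Γ hΓ
    rw [Fintype.sum_prod_type, sum_sum_eq_of_mem_piFinset_withDegree hΓ]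
  rcases Nat.even_or_odd (∑ i : Fin m × V, d i.1 i.2) with hev | hodd
  · obtain ⟨p, hp⟩ := hev.two_dvd
    rw [hY.integral_prod_pow hmean' _ _
      (variance_linearCombination_coordinates hX hcov hf s) (fun i => d i.1 i.2) p hp,
      Finset.mul_sum]
    have hsum : ∀ (h : Fin m × Sym2 V → ℕ) (q : Fin m) (w : V),
        ∑ e, h e * (if q = e.1 then endpointCount e.2 w else 0) =
          ∑ e, h (q, e) * endpointCount e w := by
      intro h q w
      rw [Fintype.sum_prod_type, Finset.sum_eq_single q]
      · simp
      · intro q' _ hq; simp [Ne.symm hq]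
      · simp
    -- An exponent on pairs (component, edge) is the same as a family of multigraphs; matching the
    -- monomial `d` fixes the degrees.
    refine Finset.sum_bij' (fun h _ q => ⟨fun e => h (q, e)⟩) (fun Γ _ e => (Γ e.1).mult e.2)
      ?_ ?_ ?_ ?_ ?_
    · intro h hh
      rw [Fintype.mem_piFinset]
      intro q
      rw [mem_withDegree]
      intro w
      rw [degree_eq_sum_endpointCount, ← hsum]
      exact congrFun (Finset.mem_filter.1 hh).2 (q, w)
    · intro Γ hΓ
      rw [Finset.mem_filter, Finset.mem_piAntidiag]
      refine ⟨⟨?_, fun _ _ => Finset.mem_univ _⟩, ?_⟩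
      · have := hdeg Γ hΓ
        rw [hp] at this
        rw [Fintype.sum_prod_type]
        exact (Nat.eq_of_mul_eq_mul_left two_pos this).symm
      · funext i
        rw [hsum]
        refine (degree_eq_sum_endpointCount (Γ i.1) i.2).symm.trans ?_
        exact mem_withDegree.1 (Fintype.mem_piFinset.1 hΓ i.1) i.2
    · intro h _; rfl
    · intro Γ _; rfl
    · intro h hh
      have hd : ∀ q w, (⟨fun e => h (q, e)⟩ : Multigraph V).degree w = d q w := fun q w => by
        rw [degree_eq_sum_endpointCount, ← hsum]
        exact congrFun (Finset.mem_filter.1 hh).2 (q, w)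
      simp_rw [symmetryFactor_eq, hd, Finset.prod_mul_distrib, Fintype.prod_prod_type, mul_assoc]
      congr 1
      have hE : ∏ e, edgeValue f s e ^
          (Multigraph.sum fun q => (⟨fun e => h (q, e)⟩ : Multigraph V)).mult e =
          ∏ q, ∏ e, edgeValue f s e ^ h (q, e) := by
        rw [Finset.prod_comm]
        refine Finset.prod_congr rfl fun e _ => ?_
        rw [Finset.prod_pow_eq_pow_sum]; rfl
      rw [hE, ← Finset.prod_mul_distrib]
      refine Finset.prod_congr rfl fun q _ => ?_
      have hdiag : ∏ e : Sym2 V, (if e.IsDiag then (1 / 2 : ℝ) else 1) ^ h (q, e) =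
          (1 / 2) ^ ∑ w, h (q, s(w, w)) := by
        rw [← sum_ite_isDiag fun e => h (q, e), ← Finset.prod_pow_eq_pow_sum]
        refine Finset.prod_congr rfl fun e _ => ?_
        split_ifs <;> simp
      simp_rw [mul_pow, Finset.prod_div_distrib, Finset.prod_mul_distrib, hdiag]
      ring
  · rw [hY.integral_prod_pow_eq_zero_of_odd hmean' (fun i => d i.1 i.2) hodd]
    refine (Finset.sum_eq_zero fun Γ hΓ => ?_).symm
    rw [hdeg Γ hΓ] at hodd
    exact absurd hodd (by simp)

end CoordinateMoments

/-! ### Symmetric functions on the ordered simplex. -/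

section Simplex

variable {I : Type*} [MeasurableSpace I] {n : ℕ}

theorem measurePreserving_comp_equiv {α β : Type*} [Fintype α] [Fintype β] (μ : Measure I)
    [SigmaFinite μ] (e : α ≃ β) :
    MeasurePreserving (fun s : β → I => s ∘ e) (Measure.pi fun _ => μ) (Measure.pi fun _ => μ) :=
  measurePreserving_arrowCongr' (fun _ => μ) (fun _ => μ) e.symm (MeasurableEquiv.refl I)
    fun _ => MeasurePreserving.id μ

theorem measurableEmbedding_comp_equiv {α β : Type*} (e : α ≃ β) :
    MeasurableEmbedding (fun s : β → I => s ∘ e) :=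
  (MeasurableEquiv.arrowCongr' e.symm (MeasurableEquiv.refl I)).measurableEmbedding

/-- Each slice of the diagonal is a single point, and `μ` has no atoms. -/
theorem measure_pi_setOf_apply_eq_apply {ι : Type*} [Fintype ι] (μ : Measure I)
    [IsProbabilityMeasure μ] [NullSingletonClass μ] [MeasurableEq I] {i j : ι} (hij : i ≠ j) :
    Measure.pi (fun _ : ι => μ) {s | s i = s j} = 0 := by
  have hind := (iIndepFun_pi (μ := fun _ : ι => μ) (X := fun _ x => x)
    fun _ => aemeasurable_id).indepFun hij
  rw [indepFun_iff_map_prod_eq_prod_map_map (measurable_pi_apply i).aemeasurable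
    (measurable_pi_apply j).aemeasurable, (measurePreserving_eval (fun _ : ι => μ) i).map_eq,
    (measurePreserving_eval (fun _ : ι => μ) j).map_eq] at hind
  have h0 : (μ.prod μ) (Set.diagonal I) = 0 := by
    rw [Measure.measure_prod_null measurableSet_diagonal]
    refine .of_forall fun x => ?_
    have : Prod.mk x ⁻¹' Set.diagonal I = {x} := by ext y; simp [eq_comm]
    simp [this]
  rw [← hind, Measure.map_apply (by fun_prop) measurableSet_diagonal] at h0
  exact h0

variable [LinearOrder I] [TopologicalSpace I] [OrderClosedTopology I] [SecondCountableTopology I]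
  [BorelSpace I]

theorem measurableSet_setOf_monotone : MeasurableSet {s : Fin n → I | Monotone s} := by
  simp only [Monotone, Set.ofPred_forall]
  exact .iInter fun i => .iInter fun j => .iInter fun _ =>
    measurableSet_le (measurable_pi_apply i) (measurable_pi_apply j)

/-- The integral of a symmetric function over the ordered simplex. -/
theorem setIntegral_monotone_of_symmetric (μ : Measure I) [IsProbabilityMeasure μ]
    [NullSingletonClass μ] {F : (Fin n → I) → ℝ} (hF : Integrable F (Measure.pi fun _ => μ))
    (hsymm : ∀ (σ : Equiv.Perm (Fin n)) s, F (s ∘ σ) = F s) :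
    ∫ s in {s | Monotone s}, F s ∂Measure.pi (fun _ => μ) =
      1 / (n.factorial : ℝ) * ∫ s, F s ∂Measure.pi fun _ => μ := by
  set ν : Measure (Fin n → I) := Measure.pi fun _ => μ
  -- The sets `A σ` cover the cube by sorting and overlap only where two coordinates coincide, a
  -- null set; by symmetry `F` has the same integral on each.
  let A : Equiv.Perm (Fin n) → Set (Fin n → I) := fun σ => (fun s => s ∘ σ) ⁻¹' {s | Monotone s}
  have hA : ∀ σ, ∫ s in A σ, F s ∂ν = ∫ s in {s | Monotone s}, F s ∂ν := by
    intro σ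
    have h := (measurePreserving_comp_equiv μ σ).setIntegral_preimage_emb
      (measurableEmbedding_comp_equiv σ) F {s | Monotone s}
    simpa only [hsymm] using h
  have hU : ⋃ σ, A σ = Set.univ := Set.eq_univ_of_forall fun s =>
    Set.mem_iUnion.2 ⟨Tuple.sort s, Tuple.monotone_sort s⟩
  have hM : ∀ σ, MeasurableSet (A σ) := fun σ =>
    (measurableEmbedding_comp_equiv σ).measurable measurableSet_setOf_monotone
  have hnull : ν {s | ¬ Function.Injective s} = 0 := by
    refine measure_mono_null (t := ⋃ i, ⋃ j, ⋃ _ : i ≠ j, {s : Fin n → I | s i = s j}) ?_ ?_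
    · intro s hs
      simp only [Set.mem_ofPred_eq, Function.Injective, not_forall] at hs
      obtain ⟨i, j, h, hij⟩ := hs
      simp only [Set.mem_iUnion]
      exact ⟨i, j, hij, h⟩
    · simp only [measure_iUnion_null_iff]
      exact fun i j hij => measure_pi_setOf_apply_eq_apply μ hij
  have hD : Pairwise (Function.onFun (AEDisjoint ν) A) := by
    intro σ τ hne
    refine measure_mono_null ?_ hnull
    rintro s ⟨hσ, hτ⟩ hinj
    refine hne (Equiv.ext fun i => hinj ?_)
    exact congrFun (Tuple.unique_monotone hσ hτ) i
  have h := integral_iUnion_ae (fun σ => (hM σ).nullMeasurableSet) hD (f := F) (μ := ν)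
    (by rw [hU]; exact hF.integrableOn)
  rw [hU, Measure.restrict_univ, tsum_fintype] at h
  simp_rw [hA] at h
  rw [h, Finset.sum_const, Finset.card_univ, Fintype.card_perm, Fintype.card_fin, nsmul_eq_mul]
  have : (n.factorial : ℝ) ≠ 0 := by exact_mod_cast n.factorial_ne_zero
  field_simp

end Simplex

/-! ### Expectation of the product of polynomials, and the theorem. -/

section PolynomialMoments

open Multigraph

variable {Ω : Type*} [MeasurableSpace Ω] {P : Measure Ω} {T : Type*} {m n : ℕ}
  {X : T → Ω → Fin m → ℝ} {V : Type*} [Fintype V]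

theorem prod_eval_eq_sum_piFinset (Q : MvPolynomial (Fin m) ℝ) (v : Fin n ≃ V)
    (x : Fin n → Fin m → ℝ) :
    ∏ k, MvPolynomial.eval (x k) Q = ∑ α ∈ Fintype.piFinset fun _ : Fin n => Q.support,
      (∏ k, Q.coeff (α k)) * ∏ i : Fin m × V, x (v.symm i.2) i.1 ^ α (v.symm i.2) i.1 := by
  simp_rw [MvPolynomial.eval_eq', Finset.prod_univ_sum, Finset.prod_mul_distrib]
  refine Finset.sum_congr rfl fun α _ => ?_
  rw [Fintype.prod_prod_type, Finset.prod_comm]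
  congr 1
  refine Finset.prod_congr rfl fun q _ => ?_
  rw [← Equiv.prod_comp v.symm]

theorem integrable_prod_eval (hX : IsGaussianProcess X P) (Q : MvPolynomial (Fin m) ℝ)
    (s : Fin n → T) : Integrable (fun ω => ∏ k, MvPolynomial.eval (X (s k) ω) Q) P := by
  simp_rw [prod_eval_eq_sum_piFinset Q (Equiv.refl (Fin n))]
  refine integrable_finsetSum _ fun α _ => Integrable.const_mul ?_ _
  exact (hX.hasGaussianLaw_coordinates s).integrable_prod_pow fun i => α i.2 i.1

theorem integral_prod_eval [DecidableEq V] [IsProbabilityMeasure P] {f : T → T → ℝ}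
    (hX : IsGaussianProcess X P) (hmean : ∀ s i, ∫ ω, X s ω i ∂P = 0)
    (hcov : ∀ s t i j,
      covariance (fun ω => X s ω i) (fun ω => X t ω j) P = if i = j then f s t else 0)
    (hf : ∀ x y, f x y = f y x) (Q : MvPolynomial (Fin m) ℝ) (v : Fin n ≃ V) (s : Fin n → T) :
    ∫ ω, ∏ k, MvPolynomial.eval (X (s k) ω) Q ∂P =
      ∑ α ∈ (Fintype.piFinset fun _ : Fin n => Q.support).filter
          fun α => Even (∑ k, ∑ i, α k i),
        (∏ k, Q.coeff (α k)) *
          ∑ Γ ∈ Fintype.piFinset fun q : Fin m => withDegree fun w : V => α (v.symm w) q,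
            (∏ q, (Γ q).symmetryFactor v) *
              ∏ e, edgeValue f (s ∘ v.symm) e ^ (Multigraph.sum Γ).mult e := by
  simp_rw [prod_eval_eq_sum_piFinset Q v]
  rw [integral_finsetSum]
  · rw [Finset.sum_filter]
    refine Finset.sum_congr rfl fun α _ => ?_
    rw [integral_const_mul]
    have h := integral_prod_pow_coordinates hX hmean hcov hf v (s ∘ v.symm)
      fun q w => α (v.symm w) q
    simp only [Function.comp_apply] at h
    rw [h]
    split_ifs with hev
    · rfl
    -- For odd total degree the sum over multigraphs is empty, so the parity filter discards
    -- nothing.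
    · refine mul_eq_zero_of_right _ (Finset.sum_eq_zero fun Γ hΓ => absurd ?_ hev)
      have h2 := sum_sum_eq_of_mem_piFinset_withDegree hΓ
      rw [Finset.sum_comm, Equiv.sum_comp v.symm fun k => ∑ q, α k q] at h2
      rw [h2]; simp
  · intro α _
    exact ((hX.hasGaussianLaw_coordinates (s ∘ v.symm)).integrable_prod_pow
      fun i => α (v.symm i.2) i.1).const_mul _

end PolynomialMoments

theorem theorem2 {Ω : Type*} [MeasurableSpace Ω] (P : Measure Ω) [IsProbabilityMeasure P]
    (m n : ℕ) (X : unitInterval → Ω → Fin m → ℝ) (hX : IsGaussianProcess X P)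
    (hmean : ∀ s i, ∫ ω, X s ω i ∂P = 0)
    (f : unitInterval → unitInterval → ℝ) (hf : Continuous (Function.uncurry f))
    (hcov : ∀ s t i j,
      covariance (fun ω => X s ω i) (fun ω => X t ω j) P = if i = j then f s t else 0)
    (Q : MvPolynomial (Fin m) ℝ)
    {V : Type*} [Fintype V] [DecidableEq V] (v : Fin n ≃ V) :
    (∀ s : Fin n → unitInterval,
      Integrable (fun ω => ∏ k, MvPolynomial.eval (X (s k) ω) Q) P) ∧
    IntegrableOn (fun s : Fin n → unitInterval => ∫ ω, ∏ k, MvPolynomial.eval (X (s k) ω) Q ∂P)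
      {s | Monotone s} ∧
    (∫ s in {s : Fin n → unitInterval | Monotone s},
        ∫ ω, ∏ k, MvPolynomial.eval (X (s k) ω) Q ∂P) =
      1 / (n.factorial : ℝ) *
        ∑ α ∈ (Fintype.piFinset fun _ : Fin n => Q.support).filter
            fun α => Even (∑ k, ∑ i, α k i),
          (∏ k, Q.coeff (α k)) *
            ∑ Γ ∈ Fintype.piFinset fun q : Fin m =>
                Multigraph.withDegree fun w : V => α (v.symm w) q,
              (∏ q, (Γ q).symmetryFactor v) *
                ∏ S ∈ (Multigraph.sum Γ).components,
                  ((Multigraph.sum Γ).induce S).integral f := by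
  -- for `m = 0` the function `f` need not be symmetric, but then it plays no role
  obtain ⟨g, hg, hsymm, hcovg, hfg⟩ : ∃ g : unitInterval → unitInterval → ℝ,
      Continuous (Function.uncurry g) ∧ (∀ x y, g x y = g y x) ∧
      (∀ s t i j, covariance (fun ω => X s ω i) (fun ω => X t ω j) P =
        if i = j then g s t else 0) ∧
      ∀ (Γ : Fin m → Multigraph V) (S : Finset V),
        ((Multigraph.sum Γ).induce S).integral f = ((Multigraph.sum Γ).induce S).integral g := by
    rcases Nat.eq_zero_or_pos m with rfl | hm
    · refine ⟨fun _ _ => 0, continuous_const, fun _ _ => rfl, fun _ _ i => i.elim0,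
        fun Γ S => ?_⟩
      simp [Multigraph.integral, Multigraph.induce, Multigraph.sum]
    · refine ⟨f, hf, fun x y => ?_, hcov, fun _ _ => rfl⟩
      -- Symmetry of `f` is inherited from the covariance of the first component with itself.
      have h1 := hcov x y ⟨0, hm⟩ ⟨0, hm⟩
      have h2 := hcov y x ⟨0, hm⟩ ⟨0, hm⟩
      rw [covariance_comm] at h1
      simpa using h1.symm.trans h2
  simp_rw [hfg]
  have hcE : ∀ (Γ : Multigraph V), Continuous fun s : V → unitInterval =>
      ∏ e, Multigraph.edgeValue g s e ^ Γ.mult e := fun Γ =>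
    continuous_finsetProd _ fun e _ => (Multigraph.continuous_edgeValue hg e).pow _
  have hcv : Continuous fun s : Fin n → unitInterval => s ∘ v.symm := by fun_prop
  have hint : ∀ Γ : Multigraph V, Integrable fun s : Fin n → unitInterval =>
      ∏ e, Multigraph.edgeValue g (s ∘ v.symm) e ^ Γ.mult e := fun Γ =>
    ((hcE Γ).comp hcv).integrable_of_hasCompactSupport (.of_compactSpace _)
  have hval : ∀ Γ : Multigraph V, ∫ s : Fin n → unitInterval,
      ∏ e, Multigraph.edgeValue g (s ∘ v.symm) e ^ Γ.mult e =
        ∏ S ∈ Γ.components, (Γ.induce S).integral g := fun Γ => by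
    rw [← Multigraph.integral_prod_edgeValue hsymm hg]
    exact (measurePreserving_comp_equiv volume v.symm).integral_comp
      (measurableEmbedding_comp_equiv v.symm)
      fun s => ∏ e, Multigraph.edgeValue g s e ^ Γ.mult e
  have hF := fun s => integral_prod_eval hX hmean hcovg hsymm Q v s
  have hFint : Integrable fun s : Fin n → unitInterval =>
      ∫ ω, ∏ k, MvPolynomial.eval (X (s k) ω) Q ∂P := by
    simp_rw [hF]
    exact integrable_finsetSum _ fun α _ => (integrable_finsetSum _ fun Γ _ =>
      (hint _).const_mul _).const_mul _
  refine ⟨fun s => integrable_prod_eval hX Q s, hFint.integrableOn, ?_⟩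
  refine (setIntegral_monotone_of_symmetric volume hFint fun σ s => ?_).trans ?_
  · refine integral_congr_ae (.of_forall fun ω => ?_)
    exact Equiv.prod_comp σ fun k => MvPolynomial.eval (X (s k) ω) Q
  · congr 1
    change ∫ s : Fin n → unitInterval, _ = _
    simp_rw [hF]
    rw [integral_finsetSum _ fun α _ => (integrable_finsetSum _ fun Γ _ =>
      (hint _).const_mul _).const_mul _]
    refine Finset.sum_congr rfl fun α _ => ?_
    rw [integral_const_mul, integral_finsetSum _ fun Γ _ => (hint _).const_mul _]
    congr 1
    refine Finset.sum_congr rfl fun Γ _ => ?_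
    rw [integral_const_mul, hval]
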